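/- Let $G=(V,E)$ be a finite simple directed planar graph (no loops, no two arcs with the same tail and the same head; antiparallel arcs are allowed) with a fixed planar embedding, given combinatorially by the clockwise cyclic order of the incident arcs around each vertex. Let $s\neq t$ be vertices of $G$, the source and the sink, such that no arc enters $s$ and no arc leaves $t$. Every arc $e$ has a capacity $c(e)\in[0,\infty]$, every vertex $v\in V\setminus\{s,t\}$ has a capacity $c(v)\in[0,\infty]$, and $c(s)=c(t)=\infty$. A function $f:E\to\mathbb R$ is a flow function in $G$ if $0\le f(e)\le c(e)$ for every $e\in E$ and, for every $v\in V\setminus\{s,t\}$, $$\sum_{e\in \mathrm{in}(v)}f(e)\le c(v),\qquad \sum_{e\in \mathrm{in}(v)}f(e)=\sum_{e\in \mathrm{out}(v)}f(e),$$ where $\mathrm{in}(v)$ and $\mathrm{out}(v)$ are the sets of arcs that enter and leave $v$. A function on $E$ is acyclic if there is no directed cycle on all of whose arcs it is positive. The extended graph $G_e$ is obtained from $G$ by replacing each vertex $v$ of finite capacity, of degree $d=|\mathrm{in}(v)|+|\mathrm{out}(v)|$, with $d$ vertices $v_0,\dots,v_{d-1}$; each arc incident to $v$ is attached to a different $v_i$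 instead, preserving the clockwise order, and for every $i$ the vertices $v_i$ and $v_{(i+1)\bmod d}$ are joined by an undirected edge of capacity $c(v)/2$, that is, by two antiparallel arcs of capacity $c(v)/2$ each. The arcs of $G$ keep their capacities and are identified with the corresponding arcs of $G_e$, the source and the sink are still $s$ and $t$, and $G_e$ has no vertex capacities (all of them are $\infty$). Let $f$ be a flow function in $G_e$, and let $\hat f$ be its restriction to the arcs of $G$. If $\hat f$ is acyclic, then $\hat f$ is a flow function in $G$; in particular it satisfies the vertex capacity constraints of $G$. Moreover, around each vertex $v$ of $G$, in the cyclic order of the incident arcs on which $\hat f$ is positive, the arcs that enter $v$ are consecutive and the arcs that leave $v$ are consecutive. -/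

import Mathlib

/-- A flow network: a directed graph with vertices `V` and arcs `E`, a source without incoming arcs,
a sink without outgoing arcs, and capacities in `[0, ∞]` on the arcs and on the vertices.
The source and the sink have no capacity, that is, capacity `∞`.
Parallel arcs and loops are excluded only by `FlowNetwork.IsSimple`. -/
structure FlowNetwork (V E : Type*) where
  tail : E → V
  head : E → V
  source : V
  sink : V
  source_ne_sink : source ≠ sink
  head_ne_source : ∀ e, head e ≠ source
  tail_ne_sink : ∀ e, tail e ≠ sink
  arcCap : E → ENNReal
  vertexCap : V → ENNReal
  vertexCap_source : vertexCap source = ⊤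
  vertexCap_sink : vertexCap sink = ⊤

namespace FlowNetwork

variable {V E : Type*}

/-- No loops and no two arcs with the same tail and the same head
(antiparallel arcs `(u, v)`, `(v, u)` are allowed). -/
def IsSimple (G : FlowNetwork V E) : Prop :=
  (∀ e, G.tail e ≠ G.head e) ∧
    ∀ e e', G.tail e = G.tail e' → G.head e = G.head e' → e = e'

open Classical in
/-- The sum of `f` over the arcs that enter `v`. -/
noncomputable def inflow [Fintype E] (G : FlowNetwork V E) (f : E → ℝ) (v : V) : ℝ :=
  ∑ e ∈ Finset.univ.filter (fun e => G.head e = v), f e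

open Classical in
/-- The sum of `f` over the arcs that leave `v`. -/
noncomputable def outflow [Fintype E] (G : FlowNetwork V E) (f : E → ℝ) (v : V) : ℝ :=
  ∑ e ∈ Finset.univ.filter (fun e => G.tail e = v), f e

/-- Flow functions: arc capacity, vertex capacity and flow conservation constraints. -/
structure IsFlow [Fintype E] (G : FlowNetwork V E) (f : E → ℝ) : Prop where
  nonneg : ∀ e, 0 ≤ f e
  le_arcCap : ∀ e, ENNReal.ofReal (f e) ≤ G.arcCap e
  le_vertexCap : ∀ v, v ≠ G.source → v ≠ G.sink →
    ENNReal.ofReal (G.inflow f v) ≤ G.vertexCap v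
  conservation : ∀ v, v ≠ G.source → v ≠ G.sink → G.inflow f v = G.outflow f v

/-- A cycle: a nonempty sequence of arcs, each starting where its predecessor ends, the first one
starting where the last one ends. -/
def IsCycle (G : FlowNetwork V E) (l : List E) : Prop :=
  l.IsChain (fun e e' => G.head e = G.tail e') ∧
    ∃ h : l ≠ [], G.head (l.getLast h) = G.tail (l.head h)

/-- `f` has no flow-cycle, that is, no cycle all of whose arcs have positive `f`-value. -/
def IsAcyclic (G : FlowNetwork V E) (f : E → ℝ) : Prop :=
  ¬ ∃ l : List E, G.IsCycle l ∧ ∀ e ∈ l, 0 < f e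

/-- The vertex at which a dart (an end of an arc) lies: `(e, false)` is the end of `e` at its tail,
`(e, true)` is the end of `e` at its head. -/
def dartVertex (G : FlowNetwork V E) (d : E × Bool) : V :=
  if d.2 then G.head d.1 else G.tail d.1

end FlowNetwork

/-- The permutation of the darts that exchanges the two ends of every arc. -/
def dartFlip (E : Type*) : Equiv.Perm (E × Bool) :=
  Equiv.prodCongr (Equiv.refl E) Equiv.boolNot

/-- The number of cycles of a permutation, fixed points included. -/
noncomputable def numCycles {D : Type*} (p : Equiv.Perm D) : ℕ :=
  Nat.card (Quotient (Equiv.Perm.SameCycle.setoid p))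

/-- A combinatorial planar embedding of the underlying graph, given by a rotation system:
`rot` sends each dart to the next one in the clockwise order around its vertex.
The faces are the cycles of `rot * dartFlip E`, the connected components (those with at least one
arc) are the orbits of the group generated by `rot` and `dartFlip E`, and the vertices that are not
isolated are the cycles of `rot`. Planarity is Euler's formula `|V| - |E| + |F| = 2 |C|`; since
every connected component satisfies `|V| - |E| + |F| ≤ 2`, it says that every component is
embedded in the sphere. Isolated vertices play no role. -/
structure PlanarEmbedding {V E : Type*} [Fintype E] (G : FlowNetwork V E) where
  rot : Equiv.Perm (E × Bool)
  sameCycle_iff : ∀ d d', rot.SameCycle d d' ↔ G.dartVertex d = G.dartVertex d'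
  euler : numCycles rot + numCycles (rot * dartFlip E) =
    Fintype.card E +
      2 * Nat.card (MulAction.orbitRel.Quotient
        (Subgroup.closure ({rot, dartFlip E} : Set (Equiv.Perm (E × Bool)))) (E × Bool))

namespace PlanarEmbedding

variable {V E : Type*} {G : FlowNetwork V E}

theorem dartVertex_rot [Fintype E] (emb : PlanarEmbedding G) (d : E × Bool) :
    G.dartVertex (emb.rot d) = G.dartVertex d :=
  ((emb.sameCycle_iff d (emb.rot d)).1 ⟨1, by simp⟩).symm

/-- The darts at capacitated vertices, that is, vertices of finite capacity. -/
abbrev CapDart (G : FlowNetwork V E) : Type _ :=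
  {d : E × Bool // G.vertexCap (G.dartVertex d) ≠ ⊤}

/-- The vertices of the extended graph: the vertices of infinite capacity, and for each vertex `v`
of finite capacity one vertex for each dart at `v`. -/
abbrev ExtVertex (G : FlowNetwork V E) : Type _ :=
  {v : V // G.vertexCap v = ⊤} ⊕ CapDart G

/-- The arcs of the extended graph: the arcs of `G`, and for each dart `d` at a vertex of finite
capacity an undirected edge between `d` and the clockwise next dart, as two antiparallel arcs. -/
abbrev ExtArc (G : FlowNetwork V E) : Type _ :=
  E ⊕ (CapDart G × Bool)

/-- The clockwise successor on the cycle `C_v` that replaces a vertex `v` of finite capacity. -/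
def next [Fintype E] (emb : PlanarEmbedding G) (d : CapDart G) : CapDart G :=
  ⟨emb.rot d.1, by rw [emb.dartVertex_rot]; exact d.2⟩

open Classical in
/-- The vertex of the extended graph to which a dart of `G` is attached. -/
noncomputable def attach (G : FlowNetwork V E) (d : E × Bool) : ExtVertex G :=
  if h : G.vertexCap (G.dartVertex d) = ⊤ then Sum.inl ⟨G.dartVertex d, h⟩ else Sum.inr ⟨d, h⟩

open Classical in
noncomputable instance instFintypeCapDart [Fintype E] (G : FlowNetwork V E) : Fintype (CapDart G) :=
  Fintype.ofFinite _

theorem attach_eq_inl {d : E × Bool} {v : {v : V // G.vertexCap v = ⊤}}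
    (h : attach G d = Sum.inl v) : G.dartVertex d = v.1 := by
  unfold attach at h
  split at h
  · exact congrArg Subtype.val (Sum.inl.inj h)
  · cases h

/-- The extended graph: each vertex `v` of finite capacity is replaced by a cycle of undirected
edges of capacity `c(v) / 2` through one new vertex for each arc incident to `v`, in the clockwise
order of these arcs. There are no vertex capacities. -/
noncomputable def extended [Fintype E] (emb : PlanarEmbedding G) : FlowNetwork (ExtVertex G) (ExtArc G) where
  tail
    | Sum.inl e => attach G (e, false)
    | Sum.inr (d, false) => Sum.inr d
    | Sum.inr (d, true) => Sum.inr (emb.next d)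
  head
    | Sum.inl e => attach G (e, true)
    | Sum.inr (d, false) => Sum.inr (emb.next d)
    | Sum.inr (d, true) => Sum.inr d
  source := Sum.inl ⟨G.source, G.vertexCap_source⟩
  sink := Sum.inl ⟨G.sink, G.vertexCap_sink⟩
  source_ne_sink := fun h => G.source_ne_sink (congrArg Subtype.val (Sum.inl.inj h))
  head_ne_source := by
    rintro (e | ⟨d, _ | _⟩) h
    · exact G.head_ne_source e (attach_eq_inl h)
    · cases h
    · cases h
  tail_ne_sink := by
    rintro (e | ⟨d, _ | _⟩) h
    · exact G.tail_ne_sink e (attach_eq_inl h)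
    · cases h
    · cases h
  arcCap
    | Sum.inl e => G.arcCap e
    | Sum.inr (d, _) => G.vertexCap (G.dartVertex d.1) / 2
  vertexCap := fun _ => ⊤
  vertexCap_source := rfl
  vertexCap_sink := rfl

/-- The restriction of a function on the arcs of the extended graph to the arcs of `G`. -/
def restrict (f : ExtArc G → ℝ) : E → ℝ := fun e => f (Sum.inl e)

/-- The darts at `v`, listed once each in clockwise order from a suitable first dart, split into two
blocks `l₁`, `l₂` such that every arc with positive `f`-value into `v` is in `l₁` and every arc
with positive `f`-value out of `v` is in `l₂`. Thus, in the cyclic order of the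
arcs incident to `v` with positive value, the incoming ones are consecutive and so are the outgoing
ones. -/
def ConsecutiveAt [Fintype E] (emb : PlanarEmbedding G) (f : E → ℝ) (v : V) : Prop :=
  ∃ l₁ l₂ : List (E × Bool),
    (l₁ ++ l₂).Nodup ∧ (∀ d, d ∈ l₁ ++ l₂ ↔ G.dartVertex d = v) ∧
      (l₁ ++ l₂).IsChain (fun d d' => d' = emb.rot d) ∧
      (∀ e, G.head e = v → 0 < f e → (e, true) ∈ l₁) ∧
      ∀ e, G.tail e = v → 0 < f e → (e, false) ∈ l₂

end PlanarEmbedding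

/-! A dart is incoming or outgoing according to the end of its arc at which it lies. Suppose first
that the arcs without flow are detached: each of their darts is alone in its cycle. Call an incoming
dart a descent at a vertex, or on a face, if its successor there is outgoing. The descents of both
kinds together number |E|. Acyclicity puts a descent on every face, since a face boundary without
one would be a directed cycle. By conservation, the only vertex cycles without a descent are those
of the source, of the sink and of ends of detached arcs, at most two per component. Euler's
inequality |E| + 2|C| ≤ |V| + |F| then leaves room for at most one descent per vertex
(`descent_unique_of_fixed`), which means that the incoming darts are consecutive.

In general, the darts without flow are detached one at a time. Each detachment multiplies the
rotation by a transposition that splits a cycle, and this preserves Euler's inequality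
(`euler_swap_mul`). Putting a dart back with the label of its predecessor creates no descent
(`exists_labelling`).

For the capacities, conservation on the ring that replaces `v` makes the net flow entering through
consecutive darts telescope to a difference of two ring flows, each at most c(v)/2 in absolute value
(`inflow_restrict_le`). -/

/-! ### Cycle counts of permutations and Euler's inequality -/

section CycleCounts

variable {D : Type*}

theorem sameCycle_setoid_le_iff {p : Equiv.Perm D} {r : Setoid D} :
    Equiv.Perm.SameCycle.setoid p ≤ r ↔ ∀ x, r x (p x) := by
  constructor
  · intro h x
    exact h (show p.SameCycle x (p x) from ⟨1, by simp⟩)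
  · intro h x y hxy
    obtain ⟨n, rfl⟩ : p.SameCycle x y := hxy
    have hinv : ∀ z, r z (p⁻¹ z) := fun z => by
      have := h (p⁻¹ z)
      simpa using r.symm this
    induction n with
    | zero => exact r.refl _
    | succ n ih =>
      rw [add_comm, zpow_add, zpow_one, Equiv.Perm.mul_apply]
      exact r.trans ih (h _)
    | pred n ih =>
      rw [sub_eq_add_neg, add_comm, zpow_add, zpow_neg_one, Equiv.Perm.mul_apply]
      exact r.trans ih (hinv _)

theorem sameCycle_setoid_mul_le (p q : Equiv.Perm D) :
    Equiv.Perm.SameCycle.setoid (p * q) ≤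
      Equiv.Perm.SameCycle.setoid p ⊔ Equiv.Perm.SameCycle.setoid q := by
  rw [sameCycle_setoid_le_iff]
  intro x
  refine Setoid.trans' _ ((le_sup_right : _ ≤ Equiv.Perm.SameCycle.setoid p ⊔ _)
    (show q.SameCycle x (q x) from ⟨1, by simp⟩)) ?_
  exact (le_sup_left : _ ≤ _ ⊔ Equiv.Perm.SameCycle.setoid q)
    (show p.SameCycle (q x) (p (q x)) from ⟨1, by simp⟩)

/-- Expresses components as a join of equivalence relations, so that components, vertices and faces
are all counted by the same lemma on classes. -/
theorem orbitRel_closure_pair (p q : Equiv.Perm D) :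
    MulAction.orbitRel (Subgroup.closure ({p, q} : Set (Equiv.Perm D))) D =
      Equiv.Perm.SameCycle.setoid p ⊔ Equiv.Perm.SameCycle.setoid q := by
  apply le_antisymm
  · rintro x y ⟨⟨g, hg⟩, rfl⟩
    suffices ∀ y, (Equiv.Perm.SameCycle.setoid p ⊔ Equiv.Perm.SameCycle.setoid q) (g y) y from
      this y
    clear y
    induction hg using Subgroup.closure_induction with
    | mem g hg =>
      intro y
      apply Setoid.symm'
      rcases hg with rfl | rfl
      · exact (sameCycle_setoid_le_iff.1 le_sup_left) y
      · exact (sameCycle_setoid_le_iff.1 le_sup_right) y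
    | one => exact fun _ => Setoid.refl' _ _
    | mul g h _ _ ihg ihh => exact fun y => Setoid.trans' _ (ihg (h y)) (ihh y)
    | inv g _ ih =>
      intro y
      simpa using Setoid.symm' _ (ih (g⁻¹ y))
  · refine sup_le (sameCycle_setoid_le_iff.2 fun x => ?_) (sameCycle_setoid_le_iff.2 fun x => ?_)
    · exact Setoid.symm' _ ⟨⟨p, Subgroup.subset_closure (by simp)⟩, rfl⟩
    · exact Setoid.symm' _ ⟨⟨q, Subgroup.subset_closure (by simp)⟩, rfl⟩

/-- The number of components of the map with the permutations `p` and `q`. -/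
noncomputable def numOrbits (p q : Equiv.Perm D) : ℕ :=
  Nat.card (Quotient (Equiv.Perm.SameCycle.setoid p ⊔ Equiv.Perm.SameCycle.setoid q))

theorem card_orbitRel_quotient (p q : Equiv.Perm D) :
    Nat.card (MulAction.orbitRel.Quotient
      (Subgroup.closure ({p, q} : Set (Equiv.Perm D))) D) = numOrbits p q := by
  unfold MulAction.orbitRel.Quotient numOrbits
  rw [orbitRel_closure_pair]

variable [DecidableEq D]

theorem sameCycle_swap (a b : D) : (Equiv.swap a b).SameCycle a b := ⟨1, by simp⟩

theorem sup_swap_eq_of_rel {r : Setoid D} {a b : D} (h : r a b) :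
    r ⊔ Equiv.Perm.SameCycle.setoid (Equiv.swap a b) = r := by
  rw [sup_eq_left, sameCycle_setoid_le_iff]
  intro x
  rw [Equiv.swap_apply_def]
  split_ifs with h1 h2
  · rw [h1]; exact h
  · rw [h2]; exact r.symm h
  · exact r.refl x

/-- Identifying two classes of an equivalence relation lowers the number of classes by one. -/
theorem card_quotient_eq_of_not_rel [Finite D] {r : Setoid D} {a b : D} (h : ¬ r a b) :
    Nat.card (Quotient r) =
      Nat.card (Quotient (r ⊔ Equiv.Perm.SameCycle.setoid (Equiv.swap a b))) + 1 := by
  classical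
  set m := r ⊔ Equiv.Perm.SameCycle.setoid (Equiv.swap a b) with hm
  let A : Quotient r := Quotient.mk r a
  let B : Quotient r := Quotient.mk r b
  have hAB : A ≠ B := fun e => h (Quotient.exact e)
  -- `F` redirects the class of `b` to that of `a`: its kernel is the join, and its range misses
  -- exactly `B`.
  let F : D → Quotient r := fun x => if Quotient.mk r x = B then A else Quotient.mk r x
  have hF : m = Setoid.ker F := by
    apply le_antisymm
    · refine sup_le (fun x y hxy => ?_) (sameCycle_setoid_le_iff.2 fun x => ?_)
      · have : Quotient.mk r x = Quotient.mk r y := Quotient.sound hxy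
        change F x = F y
        simp only [F, this]
      · change F x = F (Equiv.swap a b x)
        rw [Equiv.swap_apply_def]
        split_ifs with h1 h2
        · subst h1; simp [F, A, B]
        · subst h2; simp [F, A, B]
        · rfl
    · have key : ∀ x, ∃ z, F x = Quotient.mk r z ∧ m x z := by
        intro x
        by_cases hx : Quotient.mk r x = B
        · refine ⟨a, by simp [F, hx, A], ?_⟩
          refine Setoid.trans' _ ((le_sup_left : r ≤ m) (Quotient.exact hx)) ?_
          exact (le_sup_right : _ ≤ m) (sameCycle_swap a b).symm
        · exact ⟨x, by simp [F, hx], Setoid.refl' _ _⟩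
      intro x y hxy
      obtain ⟨z, hz, hxz⟩ := key x
      obtain ⟨w, hw, hyw⟩ := key y
      have : F x = F y := hxy
      rw [hz, hw] at this
      exact Setoid.trans' _ hxz
        (Setoid.trans' _ ((le_sup_left : r ≤ m) (Quotient.exact this)) (Setoid.symm' _ hyw))
  have hr : Set.range F = {B}ᶜ := by
    ext c
    constructor
    · rintro ⟨x, rfl⟩
      by_cases hx : Quotient.mk r x = B
      · simp [F, hx, hAB]
      · simp [F, hx]
    · intro hc
      obtain ⟨x, rfl⟩ := Quotient.exists_rep c
      exact ⟨x, if_neg hc⟩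
  rw [hF, Nat.card_congr (Setoid.quotientKerEquivRange F), hr, Nat.card_coe_set_eq]
  have := Set.ncard_compl_add_ncard ({B} : Set (Quotient r))
  rw [Set.ncard_singleton] at this
  exact this.symm

/-- The cycle counts of `p` and `swap a b * p` are compared through this common coarsening. One
inclusion suffices, because multiplying by the transposition twice restores `p`. -/
theorem sameCycle_setoid_swap_mul_sup (a b : D) (p : Equiv.Perm D) :
    Equiv.Perm.SameCycle.setoid (Equiv.swap a b * p) ⊔
        Equiv.Perm.SameCycle.setoid (Equiv.swap a b) =
      Equiv.Perm.SameCycle.setoid p ⊔ Equiv.Perm.SameCycle.setoid (Equiv.swap a b) := by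
  have key : ∀ p : Equiv.Perm D, Equiv.Perm.SameCycle.setoid (Equiv.swap a b * p) ⊔
        Equiv.Perm.SameCycle.setoid (Equiv.swap a b) ≤
      Equiv.Perm.SameCycle.setoid p ⊔ Equiv.Perm.SameCycle.setoid (Equiv.swap a b) := fun p =>
    sup_le ((sameCycle_setoid_mul_le _ _).trans (sup_comm _ _).le) le_sup_right
  refine le_antisymm (key p) ?_
  have := key (Equiv.swap a b * p)
  rwa [Equiv.swap_mul_self_mul] at this

/-- The merging case: the new permutation follows the old cycle of `a` up to `p⁻¹ a`, and from there
jumps to `b`. -/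
theorem sameCycle_swap_mul_of_not {a b : D} {p : Equiv.Perm D} [Finite D] (h : ¬ p.SameCycle a b) :
    (Equiv.swap a b * p).SameCycle a b := by
  have key : ∀ n : ℕ, (Equiv.swap a b * p).SameCycle a ((p ^ n) a) := by
    intro n
    induction n with
    | zero => exact Equiv.Perm.SameCycle.refl _ _
    | succ n ih =>
      rw [pow_succ', Equiv.Perm.mul_apply]
      by_cases h1 : p ((p ^ n) a) = a
      · rw [h1]
      · have h2 : p ((p ^ n) a) ≠ b := fun h2 => h ⟨(n + 1 : ℕ), by
          rw [zpow_natCast, pow_succ', Equiv.Perm.mul_apply, h2]⟩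
        refine ih.trans ⟨1, ?_⟩
        rw [zpow_one, Equiv.Perm.mul_apply, Equiv.swap_apply_of_ne_of_ne h1 h2]
  obtain ⟨n, hn⟩ := (show p.SameCycle a (p⁻¹ a) from ⟨-1, by simp⟩).exists_nat_pow_eq
  refine (key n).trans ⟨1, ?_⟩
  rw [hn]
  simp

/-- The splitting case: with `k` the least exponent such that `p ^ k` takes `a` to `b`, the new
cycle of `a` closes up just before reaching `b`. -/
theorem not_sameCycle_swap_mul {a b : D} {p : Equiv.Perm D} [Finite D] (hab : a ≠ b)
    (h : p.SameCycle a b) : ¬ (Equiv.swap a b * p).SameCycle a b := by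
  classical
  have hex : ∃ n : ℕ, (p ^ n) a = b := by
    exact h.exists_nat_pow_eq
  set k := Nat.find hex with hk
  have hkb : (p ^ k) a = b := Nat.find_spec hex
  have hmin : ∀ i < k, (p ^ i) a ≠ b := fun i hi => Nat.find_min hex hi
  have hna : ∀ i, 0 < i → i ≤ k → (p ^ i) a ≠ a := by
    intro i hi hik hia
    apply hmin (k - i) (by omega)
    rw [← hkb]
    conv_lhs => rw [← hia]
    rw [← Equiv.Perm.mul_apply, ← pow_add, Nat.sub_add_cancel hik]
  have hkpos : 0 < k := by
    rcases Nat.eq_zero_or_pos k with h0 | h0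
    · rw [h0] at hkb; exact absurd hkb hab
    · exact h0
  have key : ∀ n : ℕ, ∃ i < k, ((Equiv.swap a b * p) ^ n) a = (p ^ i) a := by
    intro n
    induction n with
    | zero => exact ⟨0, hkpos, rfl⟩
    | succ n ih =>
      obtain ⟨i, hi, e⟩ := ih
      rw [pow_succ', Equiv.Perm.mul_apply, e, Equiv.Perm.mul_apply, ← Equiv.Perm.mul_apply p,
        ← pow_succ']
      rcases Nat.lt_or_ge (i + 1) k with h1 | h1
      · exact ⟨i + 1, h1, Equiv.swap_apply_of_ne_of_ne (hna _ (by omega) h1.le) (hmin _ h1)⟩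
      · refine ⟨0, hkpos, ?_⟩
        rw [show i + 1 = k by omega, hkb]
        simp
  intro hs
  obtain ⟨n, hn⟩ := hs.exists_nat_pow_eq
  obtain ⟨i, hi, e⟩ := key n
  exact hmin i hi (e ▸ hn)

/-- Splitting a cycle of `p` does not increase the genus of the map with permutations `p`, `q`. -/
theorem euler_swap_mul [Finite D] {p q : Equiv.Perm D} {a b : D} {K : ℕ} (hab : a ≠ b)
    (h : p.SameCycle a b) (hK : K + 2 * numOrbits p q ≤ numCycles p + numCycles (p * q)) :
    K + 2 * numOrbits (Equiv.swap a b * p) q ≤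
      numCycles (Equiv.swap a b * p) + numCycles (Equiv.swap a b * p * q) := by
  have hp' := not_sameCycle_swap_mul hab h
  have e1 : numCycles (Equiv.swap a b * p) = numCycles p + 1 := by
    unfold numCycles
    rw [card_quotient_eq_of_not_rel (a := a) (b := b) hp', sameCycle_setoid_swap_mul_sup,
      sup_swap_eq_of_rel (r := Equiv.Perm.SameCycle.setoid p) h]
  have hJ : (Equiv.Perm.SameCycle.setoid (Equiv.swap a b * p) ⊔ Equiv.Perm.SameCycle.setoid q) ⊔
      Equiv.Perm.SameCycle.setoid (Equiv.swap a b) =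
      Equiv.Perm.SameCycle.setoid p ⊔ Equiv.Perm.SameCycle.setoid q := by
    rw [sup_right_comm, sameCycle_setoid_swap_mul_sup, sup_right_comm]
    exact sup_swap_eq_of_rel ((le_sup_left : Equiv.Perm.SameCycle.setoid p ≤ _) h)
  rw [mul_assoc]
  by_cases hq : (p * q).SameCycle a b
  · have hq' := not_sameCycle_swap_mul hab hq
    -- A face splits: vertices and faces both gain one, which pays for at most one new component,
    -- counted twice.
    have e2 : numCycles (Equiv.swap a b * (p * q)) = numCycles (p * q) + 1 := by
      unfold numCycles
      rw [card_quotient_eq_of_not_rel (a := a) (b := b) hq', sameCycle_setoid_swap_mul_sup,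
        sup_swap_eq_of_rel (r := Equiv.Perm.SameCycle.setoid (p * q)) hq]
    have e3 : numOrbits (Equiv.swap a b * p) q ≤ numOrbits p q + 1 := by
      unfold numOrbits
      by_cases hc : (Equiv.Perm.SameCycle.setoid (Equiv.swap a b * p) ⊔
          Equiv.Perm.SameCycle.setoid q) a b
      · rw [← sup_swap_eq_of_rel hc, hJ]; omega
      · rw [card_quotient_eq_of_not_rel hc, hJ]
    omega
  · have hq' := sameCycle_swap_mul_of_not hq
    -- Two faces merge: the gained vertex offsets the lost face, and the merged face keeps `a` and
    -- `b` in one component.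
    have e2 : numCycles (p * q) = numCycles (Equiv.swap a b * (p * q)) + 1 := by
      unfold numCycles
      rw [card_quotient_eq_of_not_rel (a := a) (b := b) hq, ← sameCycle_setoid_swap_mul_sup,
        sup_swap_eq_of_rel (r := Equiv.Perm.SameCycle.setoid (Equiv.swap a b * (p * q))) hq']
    have e3 : numOrbits (Equiv.swap a b * p) q = numOrbits p q := by
      unfold numOrbits
      rw [← mul_assoc] at hq'
      have hc : (Equiv.Perm.SameCycle.setoid (Equiv.swap a b * p) ⊔
          Equiv.Perm.SameCycle.setoid q) a b := sameCycle_setoid_mul_le _ _ hq'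
      rw [← sup_swap_eq_of_rel hc, hJ]
    omega

end CycleCounts

/-! ### Descents around the faces and vertices of an acyclic network -/

section Descents

variable {D : Type*}

/-- A predicate that never changes from true to false along a cycle is constant on it. -/
theorem Equiv.Perm.SameCycle.of_no_descent [Finite D] {p : Equiv.Perm D} {T : D → Prop} {d x y : D}
    (h : ∀ z, p.SameCycle d z → T z → T (p z)) (hx : p.SameCycle d x) (hxy : p.SameCycle x y)
    (hT : T x) : T y := by
  obtain ⟨n, rfl⟩ := hxy.exists_nat_pow_eq
  clear hxy
  induction n with
  | zero => exact hT
  | succ n ih =>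
    rw [pow_succ', Equiv.Perm.mul_apply]
    exact h _ (hx.trans ⟨n, by simp⟩) ih

end Descents

namespace FlowNetwork

variable {V E : Type*}

theorem not_transGen_of_not_exists_isCycle {G : FlowNetwork V E} {pos : E → Prop}
    (hac : ¬ ∃ l : List E, G.IsCycle l ∧ ∀ e ∈ l, pos e) (e : E) :
    ¬ Relation.TransGen (fun a b => pos a ∧ G.head a = G.tail b) e e := by
  intro h
  obtain ⟨c, hec, hce⟩ := Relation.TransGen.tail'_iff.1 h
  obtain ⟨l, hl, hlast⟩ := List.exists_isChain_cons_of_relationReflTransGen hec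
  refine hac ⟨e :: l, ⟨hl.imp fun _ _ h => h.2, List.cons_ne_nil _ _, ?_⟩, ?_⟩
  · rw [hlast]; exact hce.2
  -- A step of the chain asserts `pos` only of its first arc; for the last arc of the list it comes
  -- from the closing step.
  · have : ∀ (l : List E) (e : E), List.IsChain (fun a b => pos a ∧ G.head a = G.tail b) (e :: l) →
        pos ((e :: l).getLast (List.cons_ne_nil _ _)) → ∀ x ∈ e :: l, pos x := by
      intro l
      induction l with
      | nil => intro e _ h x hx; simpa using (List.mem_singleton.1 hx) ▸ h
      | cons a l ih =>
        intro e hc h x hx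
        rw [List.isChain_cons_cons] at hc
        rcases List.mem_cons.1 hx with rfl | hx
        · exact hc.1.1
        · exact ih a hc.2 (by simpa using h) x hx
    exact this l e hl (by rw [hlast]; exact hce.1)

theorem dartFlip_apply (d : E × Bool) : dartFlip E d = (d.1, !d.2) := rfl

/-- The boundary of a face is not a directed cycle: it runs through some arc backwards and through
the next one forwards. -/
theorem exists_descent_face [Finite E] {G : FlowNetwork V E} {pos : E → Prop}
    {p : Equiv.Perm (E × Bool)}
    (hfix : ∀ d, ¬ pos d.1 → p d = d)
    (hvert : ∀ d, G.dartVertex (p d) = G.dartVertex d)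
    (hac : ¬ ∃ l : List E, G.IsCycle l ∧ ∀ e ∈ l, pos e) (d : E × Bool) :
    ∃ x, (p * dartFlip E).SameCycle d x ∧ x.2 = true ∧ ((p * dartFlip E) x).2 = false := by
  by_contra hno
  push Not at hno
  set φ := p * dartFlip E with hφ
  have hφa : ∀ z, φ z = p (z.1, !z.2) := fun z => rfl
  have hpow : ∀ n : ℕ, φ.SameCycle d ((φ ^ n) d) := fun n => ⟨n, by simp⟩
  have hord : (φ ^ orderOf φ) d = d := by rw [pow_orderOf_eq_one]; rfl
  -- A face through a detached arc visits its two ends in succession, so a face of constant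
  -- direction uses only arcs with flow.
  have hconst : ∀ b, (∀ z, φ.SameCycle d z → z.2 = b) → ∀ z, φ.SameCycle d z → pos z.1 := by
    intro b hb z hz
    by_contra hp
    have h1 : φ z = (z.1, !z.2) := hfix _ hp
    have h2 := hb _ (hz.trans ⟨1, by simp⟩ : φ.SameCycle d (φ z))
    rw [h1, ← hb z hz] at h2
    simp at h2
  by_cases hT : ∃ z, φ.SameCycle d z ∧ z.2 = true
  · obtain ⟨z, hz, hzt⟩ := hT
    have hall : ∀ y, φ.SameCycle d y → y.2 = true := fun y hy =>
      Equiv.Perm.SameCycle.of_no_descent (T := fun x => x.2 = true)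
        (fun x hx h => by simpa using hno x hx h) hz (hz.symm.trans hy) hzt
    -- When all darts are incoming, the face traverses its arcs backwards.
    have hstep : ∀ y, φ.SameCycle d y → G.head (φ y).1 = G.tail y.1 := by
      intro y hy
      have h1 := hvert (y.1, !y.2)
      have h2 := hall _ (hy.trans ⟨1, by simp⟩ : φ.SameCycle d (φ y))
      rw [← hφa] at h1
      simpa [dartVertex, h2, hall y hy] using h1
    have key : ∀ n : ℕ, Relation.TransGen (fun a b => pos a ∧ G.head a = G.tail b)
        ((φ ^ (n + 1)) d).1 d.1 := by
      intro n
      have hs : ∀ n : ℕ, pos ((φ ^ (n + 1)) d).1 ∧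
          G.head ((φ ^ (n + 1)) d).1 = G.tail ((φ ^ n) d).1 := fun n =>
        ⟨hconst _ hall _ (hpow _), by
          rw [pow_succ', Equiv.Perm.mul_apply]; exact hstep _ (hpow _)⟩
      induction n with
      | zero => exact .single (hs 0)
      | succ n ih => exact .head (hs (n + 1)) ih
    have := key (orderOf φ - 1)
    rw [Nat.sub_add_cancel (orderOf_pos φ), hord] at this
    exact not_transGen_of_not_exists_isCycle hac _ this
  · have hall : ∀ y, φ.SameCycle d y → y.2 = false := fun y hy => by
      by_contra h
      exact hT ⟨y, hy, by simpa using h⟩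
    have hstep : ∀ y, φ.SameCycle d y → G.head y.1 = G.tail (φ y).1 := by
      intro y hy
      have h1 := hvert (y.1, !y.2)
      have h2 := hall _ (hy.trans ⟨1, by simp⟩ : φ.SameCycle d (φ y))
      rw [← hφa] at h1
      simpa [dartVertex, h2, hall y hy] using h1.symm
    have key : ∀ n : ℕ, Relation.TransGen (fun a b => pos a ∧ G.head a = G.tail b)
        d.1 ((φ ^ (n + 1)) d).1 := by
      intro n
      have hs : ∀ n : ℕ, pos ((φ ^ n) d).1 ∧
          G.head ((φ ^ n) d).1 = G.tail ((φ ^ (n + 1)) d).1 := fun n =>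
        ⟨hconst _ hall _ (hpow _), by
          rw [pow_succ', Equiv.Perm.mul_apply]; exact hstep _ (hpow _)⟩
      induction n with
      | zero => exact .single (hs 0)
      | succ n ih => exact .tail ih (hs (n + 1))
    have := key (orderOf φ - 1)
    rw [Nat.sub_add_cancel (orderOf_pos φ), hord] at this
    exact not_transGen_of_not_exists_isCycle hac _ this

/-- Two cycles of darts of the same direction lying in the same component coincide: they are both at
the source, both at the sink, or both consist of the same end of a detached arc. -/
theorem sameCycle_of_terminal [Finite E] {G : FlowNetwork V E} {pos : E → Prop}
    {p : Equiv.Perm (E × Bool)}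
    (hfix : ∀ d, ¬ pos d.1 → p d = d)
    (hcyc : ∀ d d', pos d.1 → pos d'.1 → G.dartVertex d = G.dartVertex d' → p.SameCycle d d')
    (hbal : ∀ v, v ≠ G.source → v ≠ G.sink →
      ((∃ e, pos e ∧ G.head e = v) ↔ ∃ e, pos e ∧ G.tail e = v))
    {b : Bool} {d d' : E × Bool} (hd : ∀ x, p.SameCycle d x → x.2 = b)
    (hd' : ∀ x, p.SameCycle d' x → x.2 = b)
    (horb : (Equiv.Perm.SameCycle.setoid p ⊔ Equiv.Perm.SameCycle.setoid (dartFlip E)) d d') :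
    p.SameCycle d d' := by
  classical
  -- `κ` is constant on components: a component either consists of arcs with flow or is a single
  -- detached arc.
  let κ : E × Bool → Option E := fun x => if pos x.1 then none else some x.1
  have hposp : ∀ x : E × Bool, pos x.1 → pos (p x).1 := by
    intro x hx
    by_contra h
    exact h ((p.injective (hfix _ h)).symm ▸ hx)
  have hκ : Equiv.Perm.SameCycle.setoid p ⊔ Equiv.Perm.SameCycle.setoid (dartFlip E) ≤
      Setoid.ker κ := by
    refine sup_le (sameCycle_setoid_le_iff.2 fun x => ?_) (sameCycle_setoid_le_iff.2 fun x => rfl)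
    change κ x = κ (p x)
    by_cases hx : pos x.1
    · simp [κ, hx, hposp x hx]
    · rw [hfix x hx]
  have hk : κ d = κ d' := hκ horb
  by_cases hp : pos d.1
  · have hp' : pos d'.1 := by
      by_contra h
      simp [κ, hp, h] at hk
    apply hcyc _ _ hp hp'
    -- Away from the source and the sink, conservation supplies flow arcs of both directions, and
    -- `hcyc` puts their darts on the same cycle.
    have key : ∀ x : E × Bool, pos x.1 → (∀ y, p.SameCycle x y → y.2 = b) →
        G.dartVertex x = if b then G.sink else G.source := by
      intro x hx hxb
      have hside : ∀ y : E × Bool, pos y.1 → G.dartVertex y = G.dartVertex x → y.2 = b :=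
        fun y hy hyx => hxb y (hcyc _ _ hx hy hyx.symm)
      have hb := hxb x (Equiv.Perm.SameCycle.refl _ _)
      by_contra hne
      by_cases hs : G.dartVertex x = G.source
      · cases b
        · exact hne hs
        · exact G.head_ne_source x.1 (by simpa [dartVertex, hb] using hs)
      by_cases ht : G.dartVertex x = G.sink
      · cases b
        · exact G.tail_ne_sink x.1 (by simpa [dartVertex, hb] using ht)
        · exact hne ht
      have hbx := hbal _ hs ht
      cases b
      · obtain ⟨e, he, hev⟩ := hbx.2 ⟨x.1, hx, by simp [dartVertex, hb]⟩
        simpa using hside (e, true) he (by simpa [dartVertex] using hev)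
      · obtain ⟨e, he, hev⟩ := hbx.1 ⟨x.1, hx, by simp [dartVertex, hb]⟩
        simpa using hside (e, false) he (by simpa [dartVertex] using hev)
    rw [key d hp hd, key d' hp' hd']
  · have hp' : ¬ pos d'.1 := by
      intro h
      simp [κ, hp, h] at hk
    have h1 : d.1 = d'.1 := by simpa [κ, hp, hp'] using hk
    have h2 : d.2 = d'.2 := (hd d (.refl _ _)).trans (hd' d' (.refl _ _)).symm
    rw [Prod.ext h1 h2]

/-- Around a vertex of a planar acyclic network, the direction of the arcs changes at most once from
incoming to outgoing; here all arcs without flow are detached from their end vertices. -/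
theorem descent_unique_of_fixed [Fintype E] {G : FlowNetwork V E} {pos : E → Prop}
    {p : Equiv.Perm (E × Bool)}
    (hfix : ∀ d, ¬ pos d.1 → p d = d)
    (hvert : ∀ d, G.dartVertex (p d) = G.dartVertex d)
    (hcyc : ∀ d d', pos d.1 → pos d'.1 → G.dartVertex d = G.dartVertex d' → p.SameCycle d d')
    (hac : ¬ ∃ l : List E, G.IsCycle l ∧ ∀ e ∈ l, pos e)
    (hbal : ∀ v, v ≠ G.source → v ≠ G.sink →
      ((∃ e, pos e ∧ G.head e = v) ↔ ∃ e, pos e ∧ G.tail e = v))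
    (heuler : Fintype.card E + 2 * numOrbits p (dartFlip E) ≤
      numCycles p + numCycles (p * dartFlip E))
    {d d' : E × Bool} (h : p.SameCycle d d') (hd : d.2 = true) (hpd : (p d).2 = false)
    (hd' : d'.2 = true) (hpd' : (p d').2 = false) : d = d' := by
  classical
  let X : Finset (E × Bool) := Finset.univ.filter fun x => x.2 = true ∧ (p x).2 = false
  let Y : Finset (E × Bool) :=
    Finset.univ.filter fun x => x.2 = true ∧ ((p * dartFlip E) x).2 = false
  -- Flipping turns `Y` into the outgoing darts with outgoing `p`-successor. Together with `X` these
  -- are all darts with outgoing successor, one for each arc.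
  have hXY : X.card + Y.card = Fintype.card E := by
    have h1 : Y.card = (Finset.univ.filter
        fun x : E × Bool => x.2 = false ∧ (p x).2 = false).card := by
      refine Finset.card_bij' (fun x _ => dartFlip E x) (fun x _ => dartFlip E x) ?_ ?_ ?_ ?_
      · intro x hx
        have hx := (Finset.mem_filter.1 hx).2
        exact Finset.mem_filter.2 ⟨Finset.mem_univ _, by simpa [dartFlip_apply] using hx⟩
      · intro x hx
        have hx := (Finset.mem_filter.1 hx).2
        exact Finset.mem_filter.2 ⟨Finset.mem_univ _, by simpa [dartFlip_apply] using hx⟩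
      · intro x _; simp [dartFlip_apply]
      · intro x _; simp [dartFlip_apply]
    have h2 : X.card + Y.card = (Finset.univ.filter fun x : E × Bool => (p x).2 = false).card := by
      rw [h1, ← Finset.card_union_of_disjoint]
      · congr 1
        ext x
        simp only [X, Finset.mem_union, Finset.mem_filter, Finset.mem_univ, true_and]
        cases x.2 <;> simp
      · rw [Finset.disjoint_filter]
        intro x _ hx hx'
        simp [hx.1] at hx'
    have h3 : (Finset.univ.filter fun x : E × Bool => (p x).2 = false).card =
        (Finset.univ : Finset E).card := by
      refine Finset.card_bij' (fun x _ => (p x).1) (fun e _ => p⁻¹ (e, false)) ?_ ?_ ?_ ?_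
      · intros; exact Finset.mem_univ _
      · intro e _; simp
      · intro x hx
        have : (p x).2 = false := by simpa using hx
        rw [← this]; simp
      · intro e _; simp
    rw [h2, h3, Finset.card_univ]
  let Q := Quotient (Equiv.Perm.SameCycle.setoid p)
  let QF := Quotient (Equiv.Perm.SameCycle.setoid (p * dartFlip E))
  let QC := Quotient
    (Equiv.Perm.SameCycle.setoid p ⊔ Equiv.Perm.SameCycle.setoid (dartFlip E))
  let mkQ : E × Bool → Q := fun x => Quotient.mk _ x
  have hF : numCycles (p * dartFlip E) ≤ Y.card := by
    have : (Finset.univ : Finset QF) ⊆ Y.image (fun x => Quotient.mk _ x) := by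
      intro c _
      obtain ⟨x, rfl⟩ := Quotient.exists_rep c
      obtain ⟨y, hy, hy1, hy2⟩ := exists_descent_face hfix hvert hac x
      exact Finset.mem_image.2 ⟨y, Finset.mem_filter.2 ⟨Finset.mem_univ _, hy1, hy2⟩,
        Quotient.sound hy.symm⟩
    calc numCycles (p * dartFlip E) = (Finset.univ : Finset QF).card := by
          unfold numCycles; rw [Nat.card_eq_fintype_card, Finset.card_univ]
      _ ≤ _ := (Finset.card_le_card this).trans Finset.card_image_le
  have hV : numCycles p ≤ (X.image mkQ).card + 2 * numOrbits p (dartFlip E) := by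
    have hterm : ∀ c : Q, c ∉ X.image mkQ →
        ∃ b : Bool, ∀ x, p.SameCycle (Quotient.out c) x → x.2 = b := by
      intro c hc
      have hno : ∀ z, p.SameCycle (Quotient.out c) z → z.2 = true → (p z).2 = true := by
        intro z hz hzt
        by_contra hzf
        apply hc
        refine Finset.mem_image.2 ⟨z, by simpa [X] using ⟨hzt, by simpa using hzf⟩, ?_⟩
        rw [← Quotient.out_eq c]
        exact Quotient.sound hz.symm
      by_cases hT : ∃ z, p.SameCycle (Quotient.out c) z ∧ z.2 = true
      · obtain ⟨z, hz, hzt⟩ := hT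
        exact ⟨true, fun y hy => Equiv.Perm.SameCycle.of_no_descent
          (T := fun x : E × Bool => x.2 = true) hno hz (hz.symm.trans hy) hzt⟩
      · refine ⟨false, fun y hy => ?_⟩
        by_contra hne
        exact hT ⟨y, hy, by simpa using hne⟩
    -- A cycle without a descent has one direction, and direction and component determine it.
    have hcard : ((X.image mkQ)ᶜ).card ≤ (Finset.univ : Finset (Bool × QC)).card := by
      refine Finset.card_le_card_of_injOn
        (fun c => ((Quotient.out c).2, (Quotient.mk _ (Quotient.out c) : QC)))
        (fun _ _ => Finset.mem_coe.2 (Finset.mem_univ _)) ?_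
      intro c hc c' hc' heq
      obtain ⟨b, hb⟩ := hterm c (by simpa using hc)
      obtain ⟨b', hb'⟩ := hterm c' (by simpa using hc')
      have h1 : (Quotient.out c).2 = (Quotient.out c').2 := congrArg Prod.fst heq
      have h2 : (Quotient.mk _ (Quotient.out c) : QC) = Quotient.mk _ (Quotient.out c') :=
        congrArg Prod.snd heq
      rw [hb _ (.refl _ _), hb' _ (.refl _ _)] at h1
      subst h1
      have := sameCycle_of_terminal hfix hcyc hbal hb hb' (Quotient.exact h2)
      rw [← Quotient.out_eq c, ← Quotient.out_eq c']
      exact Quotient.sound this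
    have hQ : numCycles p = Fintype.card Q := by
      unfold numCycles; rw [Nat.card_eq_fintype_card]
    have hQC : numOrbits p (dartFlip E) = Fintype.card QC := by
      unfold numOrbits; rw [Nat.card_eq_fintype_card]
    rw [Finset.card_univ, Fintype.card_prod, Fintype.card_bool, ← hQC] at hcard
    have := Finset.card_add_card_compl (X.image mkQ)
    rw [hQ]
    omega
  -- Euler's inequality with `hXY`, `hF` and `hV` shows that there are no more descents than cycles
  -- containing one.
  have hcard : (X.image mkQ).card = X.card := by
    refine le_antisymm Finset.card_image_le ?_
    omega
  refine Finset.card_image_iff.1 hcard ?_ ?_ (Quotient.sound h)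
  · simpa [X] using ⟨hd, hpd⟩
  · simpa [X] using ⟨hd', hpd'⟩

/-- The darts of a planar acyclic network can be labelled, those of the arcs with flow by their
direction, such that around a vertex the label changes at most once from incoming to outgoing. -/
theorem exists_labelling [Fintype E] {G : FlowNetwork V E} {pos : E → Prop}
    {p : Equiv.Perm (E × Bool)}
    (hvert : ∀ d, G.dartVertex (p d) = G.dartVertex d)
    (hcyc : ∀ d d', pos d.1 → pos d'.1 → G.dartVertex d = G.dartVertex d' → p.SameCycle d d')
    (hac : ¬ ∃ l : List E, G.IsCycle l ∧ ∀ e ∈ l, pos e)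
    (hbal : ∀ v, v ≠ G.source → v ≠ G.sink →
      ((∃ e, pos e ∧ G.head e = v) ↔ ∃ e, pos e ∧ G.tail e = v))
    (heuler : Fintype.card E + 2 * numOrbits p (dartFlip E) ≤
      numCycles p + numCycles (p * dartFlip E)) :
    ∃ σ : E × Bool → Bool, (∀ d, pos d.1 → σ d = d.2) ∧
      ∀ d d', p.SameCycle d d' → σ d = true → σ (p d) = false → σ d' = true → σ (p d') = false →
        d = d' := by
  classical
  induction hn : (Finset.univ.filter fun d : E × Bool => ¬ pos d.1 ∧ p d ≠ d).card using
    Nat.strong_induction_on generalizing p with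
  | _ n ih =>
  by_cases hfix : ∀ d : E × Bool, ¬ pos d.1 → p d = d
  · exact ⟨Prod.snd, fun _ _ => rfl, fun d d' h h1 h2 h3 h4 =>
      descent_unique_of_fixed hfix hvert hcyc hac hbal heuler h h1 h2 h3 h4⟩
  push Not at hfix
  obtain ⟨c, hcpos, hc⟩ := hfix
  -- `p'` fixes `c` and sends the predecessor of `c` directly to `p c`.
  set p' := Equiv.swap c (p c) * p with hp'
  have hp'c : p' c = c := by simp [p']
  have hp'pre : ∀ x, x ≠ c → p x = c → p' x = p c := fun x _ hx => by simp [p', hx]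
  have hp'o : ∀ x, x ≠ c → p x ≠ c → p' x = p x := fun x hx hpx => by
    rw [hp', Equiv.Perm.mul_apply]
    exact Equiv.swap_apply_of_ne_of_ne hpx (fun h => hx (p.injective h))
  have hpinv : p⁻¹ c ≠ c := fun h => hc (by nth_rewrite 1 [← h]; simp)
  -- Labels are pulled back along `r`, so `c` inherits the label of its predecessor.
  let r : E × Bool → E × Bool := fun x => if x = c then p⁻¹ c else x
  have hrc : r c = p⁻¹ c := if_pos rfl
  have hro : ∀ x, x ≠ c → r x = x := fun x hx => if_neg hx
  have hstep : ∀ x, p x ≠ c → p' (r x) = r (p x) := by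
    intro x hx
    by_cases hxc : x = c
    · subst hxc
      rw [hrc, hro _ hc]
      exact hp'pre _ hpinv (by simp)
    · rw [hro _ hxc, hro _ hx, hp'o x hxc hx]
  have hstep' : ∀ x, p x = c → r (p x) = r x := by
    intro x hx
    rw [hx, hrc, hro x (fun h => hc (h ▸ hx)), ← hx]
    simp
  have hSC : ∀ x y, p.SameCycle x y → p'.SameCycle (r x) (r y) := by
    have : Equiv.Perm.SameCycle.setoid p ≤ (Equiv.Perm.SameCycle.setoid p').comap r := by
      refine sameCycle_setoid_le_iff.2 fun x => ?_
      change p'.SameCycle (r x) (r (p x))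
      by_cases hx : p x = c
      · rw [hstep' x hx]
      · exact ⟨1, by rw [zpow_one, hstep x hx]⟩
    exact fun x y h => this h
  have hposne : ∀ x : E × Bool, pos x.1 → x ≠ c := fun x hx h => hcpos (h ▸ hx)
  have hlt : (Finset.univ.filter fun d : E × Bool => ¬ pos d.1 ∧ p' d ≠ d).card < n := by
    rw [← hn]
    apply Finset.card_lt_card
    refine Finset.ssubset_iff_of_subset ?_ |>.2 ⟨c, by simpa using ⟨hcpos, hc⟩, by simp [hp'c]⟩
    intro x hx
    simp only [Finset.mem_filter, Finset.mem_univ, true_and] at hx ⊢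
    refine ⟨hx.1, fun hpx => hx.2 ?_⟩
    have hxc : x ≠ c := fun h => hc (h ▸ hpx)
    rw [hp'o x hxc (by rwa [hpx]), hpx]
  have hvert' : ∀ x, G.dartVertex (p' x) = G.dartVertex x := by
    intro x
    by_cases hxc : x = c
    · rw [hxc, hp'c]
    · by_cases hx : p x = c
      · rw [hp'pre x hxc hx, hvert, ← hvert x, hx]
      · rw [hp'o x hxc hx, hvert]
  have hcyc' : ∀ x y, pos x.1 → pos y.1 → G.dartVertex x = G.dartVertex y →
      p'.SameCycle x y := by
    intro x y hx hy hxy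
    have := hSC x y (hcyc x y hx hy hxy)
    rwa [hro _ (hposne x hx), hro _ (hposne y hy)] at this
  obtain ⟨σ, hσ, hdesc⟩ := ih _ hlt hvert' hcyc'
    (euler_swap_mul hc.symm ⟨1, by simp⟩ heuler) rfl
  refine ⟨fun x => σ (r x), fun d hd => by simp only [hro _ (hposne d hd)]; exact hσ d hd, ?_⟩
  intro d d' h h1 h2 h3 h4
  have hne : ∀ x, σ (r x) = true → σ (r (p x)) = false → p x ≠ c := by
    intro x hx1 hx2 hx
    rw [hstep' x hx, hx1] at hx2
    cases hx2
  have hdc := hne d h1 h2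
  have hdc' := hne d' h3 h4
  have hr := hdesc (r d) (r d') (hSC _ _ h) h1 (by rw [hstep _ hdc]; exact h2) h3
    (by rw [hstep _ hdc']; exact h4)
  -- If just one of the two descents is `c`, the other is `p⁻¹ c`, whose step leads into `c` and so
  -- is no descent.
  by_cases hd : d = c <;> by_cases hd' : d' = c
  · rw [hd, hd']
  · rw [hd, hrc, hro _ hd'] at hr
    exact absurd (by rw [← hr]; simp) hdc'
  · rw [hd', hrc, hro _ hd] at hr
    exact absurd (by rw [hr]; simp) hdc
  · rwa [hro _ hd, hro _ hd'] at hr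

end FlowNetwork

/-! ### Cutting a cycle into two blocks of constant label -/

section CycleLists

variable {D : Type*}

theorem exists_descent_between {b : ℕ → Bool} {m n : ℕ} (hmn : m ≤ n) (hm : b m = true)
    (hn : b n = false) : ∃ k, m ≤ k ∧ k < n ∧ b k = true ∧ b (k + 1) = false := by
  induction n, hmn using Nat.le_induction with
  | base => rw [hm] at hn; cases hn
  | succ n hmn ih =>
    by_cases h : b n = true
    · exact ⟨n, hmn, n.lt_succ_self, h, hn⟩
    · obtain ⟨k, h1, h2, h3⟩ := ih (by simpa using h)
      exact ⟨k, h1, h2.trans n.lt_succ_self, h3⟩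

/-- If a label changes at most once from true to false along a cycle, then there is a first element
from which on the elements with label true precede those with label false. -/
theorem exists_start_antitone [Finite D] {p : Equiv.Perm D} {σ : D → Bool}
    (hdesc : ∀ d d', p.SameCycle d d' → σ d = true → σ (p d) = false → σ d' = true →
      σ (p d') = false → d = d') (d : D) :
    ∃ w, p.SameCycle d w ∧ ∀ i j, i ≤ j → j < Function.minimalPeriod p w →
      σ (p^[i] w) = false → σ (p^[j] w) = false := by
  have hit : ∀ w (i : ℕ), p.SameCycle w (p^[i] w) := fun w i =>
    ⟨i, by rw [zpow_natCast, Equiv.Perm.iterate_eq_pow]⟩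
  by_cases hasc : ∃ u, p.SameCycle d u ∧ σ u = false ∧ σ (p u) = true
  · obtain ⟨u, hdu, hu, hpu⟩ := hasc
    -- Started just after an ascent, the list begins with true and ends at `u` with false. A false
    -- before a true would then force two distinct descents.
    refine ⟨p u, hdu.trans ⟨1, by simp⟩, fun i j hij hj hi => ?_⟩
    set w := p u with hw
    by_contra hjt
    rw [Bool.not_eq_false] at hjt
    set n := Function.minimalPeriod p w with hn
    have hlast : p^[n - 1] w = u := by
      apply p.injective
      rw [← Function.iterate_succ_apply' p, Nat.succ_eq_add_one, Nat.sub_add_cancel (by omega), hn,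
        Function.iterate_minimalPeriod]
    obtain ⟨k, -, hki, hk1, hk2⟩ :=
      exists_descent_between (b := fun i => σ (p^[i] w)) (Nat.zero_le i) hpu hi
    obtain ⟨k', hjk', hk'n, hk'1, hk'2⟩ :=
      exists_descent_between (b := fun i => σ (p^[i] w)) (m := j) (n := n - 1) (by omega) hjt
        (by simpa only [hlast] using hu)
    simp only [Function.iterate_succ_apply'] at hk2 hk'2
    have := hdesc _ _ ((hit w k).symm.trans (hit w k')) hk1 hk2 hk'1 hk'2
    have := Function.iterate_injOn_Iio_minimalPeriod (f := p) (x := w)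
      (Set.mem_Iio.2 (by omega)) (Set.mem_Iio.2 (by omega)) this
    omega
  · push Not at hasc
    refine ⟨d, .refl _ _, fun i j _ _ hi => ?_⟩
    exact Equiv.Perm.SameCycle.of_no_descent (T := fun x => σ x = false)
      (fun z hz h => by simpa using hasc z hz h) (hit d i) ((hit d i).symm.trans (hit d j)) hi

theorem exists_cycle_split [Finite D] {p : Equiv.Perm D} {σ : D → Bool}
    (hdesc : ∀ d d', p.SameCycle d d' → σ d = true → σ (p d) = false → σ d' = true →
      σ (p d') = false → d = d') (d : D) :
    ∃ l₁ l₂ : List D, (l₁ ++ l₂).Nodup ∧ (∀ x, x ∈ l₁ ++ l₂ ↔ p.SameCycle d x) ∧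
      (l₁ ++ l₂).IsChain (fun x y => y = p x) ∧ (∀ x ∈ l₁, σ x = true) ∧ ∀ x ∈ l₂, σ x = false := by
  classical
  obtain ⟨w, hw, hanti⟩ := exists_start_antitone hdesc d
  set n := Function.minimalPeriod p w with hn
  -- The cut is at the first false label, or at the end if there is none.
  have hex : ∃ i, n ≤ i ∨ σ (p^[i] w) = false := ⟨n, .inl le_rfl⟩
  set k := Nat.find hex with hk
  have hkn : k ≤ n := Nat.find_min' hex (.inl le_rfl)
  have happ : (List.range' 0 k).map (fun i => p^[i] w) ++
      (List.range' k (n - k)).map (fun i => p^[i] w) = (List.range n).map (fun i => p^[i] w) := by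
    rw [← List.map_append, List.range_eq_range']
    congr 1
    have := List.range'_append (s := 0) (m := k) (n := n - k) (step := 1)
    simpa [Nat.add_sub_cancel' hkn] using this
  refine ⟨(List.range' 0 k).map (fun i => p^[i] w), (List.range' k (n - k)).map (fun i => p^[i] w),
    ?_, ?_, ?_, ?_, ?_⟩
  · rw [happ]
    refine List.Nodup.map_on ?_ List.nodup_range
    intro i hi j hj h
    exact Function.iterate_injOn_Iio_minimalPeriod (f := p) (x := w)
      (by simpa using hi) (by simpa using hj) h
  · intro x
    rw [happ, List.mem_map]
    constructor
    · rintro ⟨i, -, rfl⟩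
      exact hw.trans ⟨i, by rw [zpow_natCast, Equiv.Perm.iterate_eq_pow]⟩
    · intro hx
      obtain ⟨i, hi⟩ := (hw.symm.trans hx).exists_nat_pow_eq
      have hpos : 0 < n := Function.minimalPeriod_pos_of_mem_periodicPts
        (p.injective.mem_periodicPts w)
      refine ⟨i % n, List.mem_range.2 (Nat.mod_lt _ hpos), ?_⟩
      rw [hn, Function.iterate_mod_minimalPeriod_eq, Equiv.Perm.iterate_eq_pow, hi]
  · rw [happ, List.isChain_map, List.isChain_iff_getElem]
    intro i hi
    simp [Function.iterate_succ_apply']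
  · intro x hx
    obtain ⟨i, hi, rfl⟩ := List.mem_map.1 hx
    have hik : i < k := by simpa using (List.mem_range'_1.1 hi).2
    have := Nat.find_min hex hik
    push Not at this
    simpa using this.2
  · intro x hx
    obtain ⟨i, hi, rfl⟩ := List.mem_map.1 hx
    have hik := List.mem_range'_1.1 hi
    have hin : i < n := by omega
    rcases Nat.find_spec hex with h | h
    · omega
    · exact hanti _ _ hik.1 hin h

/-- Applied with `s` the flow that darts carry into a ring and `g` the flow along the ring, so that
only the two ring edges bounding a block matter. -/
theorem sum_map_telescope {p : Equiv.Perm D} {s g : D → ℝ} (a : D) (l : List D)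
    (hc : (a :: l).IsChain (fun x y => y = p x))
    (hs : ∀ x ∈ a :: l, s x = g x - g (p⁻¹ x)) :
    ((a :: l).map s).sum = g ((a :: l).getLast (List.cons_ne_nil _ _)) - g (p⁻¹ a) := by
  induction l generalizing a with
  | nil => simpa using hs a
  | cons b l ih =>
    rw [List.isChain_cons_cons] at hc
    rw [List.map_cons, List.sum_cons, ih b hc.2 (fun x hx => hs x (List.mem_cons_of_mem _ hx)),
      hs a List.mem_cons_self, hc.1]
    simp

end CycleLists

/-! ### Consecutive arcs in a conserved acyclic flow -/

theorem FlowNetwork.inflow_pos_iff {V E : Type*} [Fintype E] {G : FlowNetwork V E} {f : E → ℝ}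
    (hf : ∀ e, 0 ≤ f e) (v : V) : 0 < G.inflow f v ↔ ∃ e, 0 < f e ∧ G.head e = v := by
  classical
  unfold FlowNetwork.inflow
  constructor
  · intro h
    obtain ⟨e, he, hpos⟩ := Finset.exists_lt_of_sum_lt (f := fun _ => (0 : ℝ)) (by simpa using h)
    exact ⟨e, hpos, (Finset.mem_filter.1 he).2⟩
  · rintro ⟨e, he, hv⟩
    exact Finset.sum_pos' (fun e _ => hf e) ⟨e, Finset.mem_filter.2 ⟨Finset.mem_univ _, hv⟩, he⟩

theorem FlowNetwork.outflow_pos_iff {V E : Type*} [Fintype E] {G : FlowNetwork V E} {f : E → ℝ}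
    (hf : ∀ e, 0 ≤ f e) (v : V) : 0 < G.outflow f v ↔ ∃ e, 0 < f e ∧ G.tail e = v := by
  classical
  unfold FlowNetwork.outflow
  constructor
  · intro h
    obtain ⟨e, he, hpos⟩ := Finset.exists_lt_of_sum_lt (f := fun _ => (0 : ℝ)) (by simpa using h)
    exact ⟨e, hpos, (Finset.mem_filter.1 he).2⟩
  · rintro ⟨e, he, hv⟩
    exact Finset.sum_pos' (fun e _ => hf e) ⟨e, Finset.mem_filter.2 ⟨Finset.mem_univ _, hv⟩, he⟩

namespace PlanarEmbedding

variable {V E : Type*} {G : FlowNetwork V E}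

theorem consecutiveAt_of_labelling [Fintype E] (emb : PlanarEmbedding G) {f : E → ℝ}
    {σ : E × Bool → Bool} (hσ : ∀ d, 0 < f d.1 → σ d = d.2)
    (hdesc : ∀ d d', emb.rot.SameCycle d d' → σ d = true → σ (emb.rot d) = false → σ d' = true →
      σ (emb.rot d') = false → d = d') (v : V) : emb.ConsecutiveAt f v := by
  by_cases hv : ∃ d, G.dartVertex d = v
  · obtain ⟨d, rfl⟩ := hv
    obtain ⟨l₁, l₂, hnd, hmem, hchain, h1, h2⟩ := exists_cycle_split hdesc d
    have hmem' : ∀ x, x ∈ l₁ ++ l₂ ↔ G.dartVertex x = G.dartVertex d := fun x =>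
      (hmem x).trans ((emb.sameCycle_iff d x).trans eq_comm)
    refine ⟨l₁, l₂, hnd, hmem', hchain, fun e he hpos => ?_, fun e he hpos => ?_⟩
    · refine (List.mem_append.1 ((hmem' (e, true)).2 he)).resolve_right fun h => ?_
      have := h2 _ h
      rw [hσ _ hpos] at this
      cases this
    · refine (List.mem_append.1 ((hmem' (e, false)).2 he)).resolve_left fun h => ?_
      have := h1 _ h
      rw [hσ _ hpos] at this
      cases this
  · push Not at hv
    exact ⟨[], [], List.nodup_nil, fun d => by simp [hv d], List.isChain_nil,
      fun e he => absurd he (hv (e, true)), fun e he => absurd he (hv (e, false))⟩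

/-- A planar acyclic flow that is conserved at all vertices other than the source and the sink
enters and leaves every vertex along consecutive arcs. -/
theorem consecutiveAt_of_isAcyclic [Fintype E] (emb : PlanarEmbedding G) {f : E → ℝ}
    (hnonneg : ∀ e, 0 ≤ f e)
    (hcons : ∀ v, v ≠ G.source → v ≠ G.sink → G.inflow f v = G.outflow f v)
    (hac : G.IsAcyclic f) (v : V) : emb.ConsecutiveAt f v := by
  have heuler : Fintype.card E + 2 * numOrbits emb.rot (dartFlip E) ≤
      numCycles emb.rot + numCycles (emb.rot * dartFlip E) := by
    rw [emb.euler, card_orbitRel_quotient]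
  obtain ⟨σ, hσ, hdesc⟩ := FlowNetwork.exists_labelling (pos := fun e => 0 < f e)
    emb.dartVertex_rot (fun d d' _ _ h => (emb.sameCycle_iff d d').2 h) hac
    (fun v hs ht => by
      rw [← FlowNetwork.inflow_pos_iff hnonneg, ← FlowNetwork.outflow_pos_iff hnonneg,
        hcons v hs ht]) heuler
  exact emb.consecutiveAt_of_labelling hσ hdesc v

/-! ### Flow on the rings of the extended graph -/

/-- The flow that a dart carries towards its vertex. -/
def dartFlow (f : E → ℝ) (d : E × Bool) : ℝ := if d.2 then f d.1 else -f d.1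

open Classical in
/-- The net flow in the extended graph from the vertex of a dart to that of the clockwise next
dart. -/
noncomputable def ringFlow (f : ExtArc G → ℝ) (d : E × Bool) : ℝ :=
  if h : G.vertexCap (G.dartVertex d) ≠ ⊤ then
    f (Sum.inr (⟨d, h⟩, false)) - f (Sum.inr (⟨d, h⟩, true)) else 0

theorem attach_eq_inl_iff {d : E × Bool} {v : {v : V // G.vertexCap v = ⊤}} :
    attach G d = Sum.inl v ↔ G.dartVertex d = v.1 := by
  refine ⟨attach_eq_inl, fun h => ?_⟩
  unfold attach
  rw [dif_pos (by rw [h]; exact v.2)]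
  exact congrArg Sum.inl (Subtype.ext h)

theorem attach_eq_inr_iff {d : E × Bool} {c : CapDart G} :
    attach G d = Sum.inr c ↔ d = c.1 := by
  unfold attach
  constructor
  · intro h
    split at h
    · cases h
    · exact congrArg Subtype.val (Sum.inr.inj h)
  · rintro rfl
    rw [dif_neg c.2]

theorem next_injective [Fintype E] (emb : PlanarEmbedding G) : Function.Injective emb.next :=
  fun _ _ h => Subtype.ext (emb.rot.injective (congrArg Subtype.val h))

/-- Flow conservation at a vertex of a cycle of the extended graph. -/
theorem dartFlow_rot [Fintype E] (emb : PlanarEmbedding G) {f : ExtArc G → ℝ}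
    (hf : emb.extended.IsFlow f) {d : E × Bool} (hd : G.vertexCap (G.dartVertex d) ≠ ⊤) :
    dartFlow (restrict f) (emb.rot d) = ringFlow f (emb.rot d) - ringFlow f d := by
  classical
  let c : CapDart G := ⟨d, hd⟩
  have h := hf.conservation (Sum.inr (emb.next c)) (fun h => by cases h) (fun h => by cases h)
  have hd' : G.vertexCap (G.dartVertex (emb.rot d)) ≠ ⊤ := (emb.next c).2
  have hin : emb.extended.inflow f (Sum.inr (emb.next c)) =
      (if (emb.rot d).2 = true then f (Sum.inl (emb.rot d).1) else 0) +
        (f (Sum.inr (emb.next c, true)) + f (Sum.inr (c, false))) := by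
    unfold FlowNetwork.inflow
    rw [Finset.sum_filter, Fintype.sum_sum_type, Fintype.sum_prod_type_right, Fintype.sum_bool]
    simp only [extended, attach_eq_inr_iff, Sum.inr.injEq, emb.next_injective.eq_iff]
    simp only [Finset.sum_ite_eq', Finset.mem_univ, if_true]
    congr 1
    change (∑ e, if (e, true) = emb.rot d then f (Sum.inl e) else 0) = _
    split_ifs with hb
    · rw [Finset.sum_eq_single (emb.rot d).1]
      · exact if_pos (show ((emb.rot d).1, true) = emb.rot d from Prod.ext rfl hb.symm)
      · intro e _ he
        exact if_neg fun h => he (congrArg Prod.fst h)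
      · simp
    · exact Finset.sum_eq_zero fun e _ => if_neg fun h => hb (congrArg Prod.snd h).symm
  have hout : emb.extended.outflow f (Sum.inr (emb.next c)) =
      (if (emb.rot d).2 = true then 0 else f (Sum.inl (emb.rot d).1)) +
        (f (Sum.inr (c, true)) + f (Sum.inr (emb.next c, false))) := by
    unfold FlowNetwork.outflow
    rw [Finset.sum_filter, Fintype.sum_sum_type, Fintype.sum_prod_type_right, Fintype.sum_bool]
    simp only [extended, attach_eq_inr_iff, Sum.inr.injEq, emb.next_injective.eq_iff]
    simp only [Finset.sum_ite_eq', Finset.mem_univ, if_true]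
    congr 1
    change (∑ e, if (e, false) = emb.rot d then f (Sum.inl e) else 0) = _
    split_ifs with hb
    · exact Finset.sum_eq_zero fun e _ => if_neg fun h => by
        rw [← h] at hb; cases hb
    · rw [Finset.sum_eq_single (emb.rot d).1]
      · exact if_pos (show ((emb.rot d).1, false) = emb.rot d from
          Prod.ext rfl (by simpa using hb))
      · intro e _ he
        exact if_neg fun h => he (congrArg Prod.fst h)
      · simp
  rw [hin, hout] at h
  have h1 : ringFlow f d = f (Sum.inr (c, false)) - f (Sum.inr (c, true)) := dif_pos hd
  have h2 : ringFlow f (emb.rot d) =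
      f (Sum.inr (emb.next c, false)) - f (Sum.inr (emb.next c, true)) := dif_pos hd'
  rw [h1, h2]
  unfold dartFlow restrict
  split_ifs at h ⊢ <;> linarith

theorem abs_ringFlow_le [Fintype E] (emb : PlanarEmbedding G) {f : ExtArc G → ℝ}
    (hf : emb.extended.IsFlow f) {d : E × Bool} (hd : G.vertexCap (G.dartVertex d) ≠ ⊤) :
    |ringFlow f d| ≤ (G.vertexCap (G.dartVertex d)).toReal / 2 := by
  have hle : ∀ b, f (Sum.inr (⟨d, hd⟩, b)) ≤ (G.vertexCap (G.dartVertex d)).toReal / 2 := by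
    intro b
    have h : ENNReal.ofReal (f (Sum.inr (⟨d, hd⟩, b))) ≤ G.vertexCap (G.dartVertex d) / 2 :=
      hf.le_arcCap (Sum.inr (⟨d, hd⟩, b))
    have h2 : G.vertexCap (G.dartVertex d) / 2 ≠ ⊤ := ENNReal.div_ne_top hd (by norm_num)
    rw [ENNReal.ofReal_le_iff_le_toReal h2, ENNReal.toReal_div] at h
    simpa using h
  have h0 := fun b => hf.nonneg (Sum.inr (⟨d, hd⟩, b))
  unfold ringFlow
  rw [dif_pos hd, abs_le]
  constructor <;> linarith [hle true, hle false, h0 true, h0 false]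

/-- At a vertex of finite capacity, the conservation equations of its ring are summed; the ring
flows cancel because `rot` permutes the darts at `v`. -/
theorem restrict_conservation [Fintype E] (emb : PlanarEmbedding G) {f : ExtArc G → ℝ}
    (hf : emb.extended.IsFlow f) {v : V} (hs : v ≠ G.source) (ht : v ≠ G.sink) :
    G.inflow (restrict f) v = G.outflow (restrict f) v := by
  classical
  by_cases hv : G.vertexCap v = ⊤
  · have h := hf.conservation (Sum.inl ⟨v, hv⟩)
      (fun h => hs (congrArg Subtype.val (Sum.inl.inj h)))
      (fun h => ht (congrArg Subtype.val (Sum.inl.inj h)))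
    unfold FlowNetwork.inflow FlowNetwork.outflow at h ⊢
    rw [Finset.sum_filter, Finset.sum_filter, Fintype.sum_sum_type, Fintype.sum_sum_type,
      Fintype.sum_prod_type_right, Fintype.sum_prod_type_right, Fintype.sum_bool,
      Fintype.sum_bool] at h
    simp only [extended, attach_eq_inl_iff, reduceCtorEq, if_false, Finset.sum_const_zero,
      add_zero] at h
    rw [Finset.sum_filter, Finset.sum_filter]
    exact h
  · have h1 : G.inflow (restrict f) v - G.outflow (restrict f) v =
        ∑ d : E × Bool, if G.dartVertex d = v then dartFlow (restrict f) d else 0 := by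
      unfold FlowNetwork.inflow FlowNetwork.outflow
      rw [Finset.sum_filter, Finset.sum_filter, Fintype.sum_prod_type_right, Fintype.sum_bool,
        sub_eq_add_neg, ← Finset.sum_neg_distrib]
      simp only [FlowNetwork.dartVertex, dartFlow, Bool.false_eq_true, if_true, if_false]
      refine congrArg _ (Finset.sum_congr rfl fun e _ => ?_)
      split_ifs <;> simp
    have h2 : ∀ g : E × Bool → ℝ, (∑ d, if G.dartVertex d = v then g (emb.rot d) else 0) =
        ∑ d, if G.dartVertex d = v then g d else 0 := by
      intro g
      rw [← Equiv.sum_comp emb.rot (fun d => if G.dartVertex d = v then g d else 0)]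
      simp only [emb.dartVertex_rot]
    rw [← sub_eq_zero, h1, ← h2]
    have h3 : ∀ d, (if G.dartVertex d = v then dartFlow (restrict f) (emb.rot d) else 0) =
        (if G.dartVertex d = v then ringFlow f (emb.rot d) else 0) -
          if G.dartVertex d = v then ringFlow f d else 0 := by
      intro d
      split_ifs with hd
      · exact emb.dartFlow_rot hf (hd ▸ hv)
      · simp
    simp only [h3, Finset.sum_sub_distrib, h2, sub_self]

/-- The incoming darts of a vertex of finite capacity are consecutive, so that the flow leaves
them through two edges of capacity `c(v) / 2` of the cycle. -/
theorem inflow_restrict_le [Fintype E] (emb : PlanarEmbedding G) {f : ExtArc G → ℝ}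
    (hf : emb.extended.IsFlow f) {v : V} (hv : G.vertexCap v ≠ ⊤)
    (hcon : emb.ConsecutiveAt (restrict f) v) :
    G.inflow (restrict f) v ≤ (G.vertexCap v).toReal := by
  classical
  obtain ⟨l₁, l₂, hnd, hmem, hchain, hin, hout⟩ := hcon
  have hzero : ∀ e, ¬ 0 < restrict f e → restrict f e = 0 := fun e h =>
    le_antisymm (not_lt.1 h) (hf.nonneg _)
  have hsum : G.inflow (restrict f) v = (l₁.map (dartFlow (restrict f))).sum := by
    rw [← List.sum_toFinset _ (List.nodup_append.1 hnd).1]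
    have : ∑ d ∈ l₁.toFinset, dartFlow (restrict f) d =
        ∑ d : E × Bool, if d ∈ l₁ then dartFlow (restrict f) d else 0 := by
      rw [← Finset.sum_filter]
      congr 1
      ext d
      simp
    rw [this, Fintype.sum_prod_type_right, Fintype.sum_bool, ← Finset.sum_add_distrib]
    unfold FlowNetwork.inflow
    rw [Finset.sum_filter]
    refine Finset.sum_congr rfl fun e _ => ?_
    -- The block `l₁` may contain outgoing darts, but only of arcs without flow.
    have hfalse : (if (e, false) ∈ l₁ then dartFlow (restrict f) (e, false) else 0) = 0 := by
      split_ifs with h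
      · have : ¬ 0 < restrict f e := fun hp => List.disjoint_of_nodup_append hnd h
          (hout e ((hmem _).1 (List.mem_append_left _ h)) hp)
        simp [dartFlow, hzero e this]
      · rfl
    rw [hfalse, add_zero]
    by_cases h : (e, true) ∈ l₁
    · rw [if_pos h, if_pos (show G.head e = v from (hmem _).1 (List.mem_append_left _ h))]
      simp [dartFlow]
    · rw [if_neg h]
      split_ifs with hh
      · exact hzero e fun hp => h (hin e hh hp)
      · rfl
  rw [hsum]
  have hat : ∀ x ∈ l₁, G.dartVertex x = v := fun x hx => (hmem x).1 (List.mem_append_left _ hx)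
  rcases l₁ with _ | ⟨a, l⟩
  · simp
  · have hinv : ∀ x, G.dartVertex (emb.rot⁻¹ x) = G.dartVertex x := fun x => by
      rw [← emb.dartVertex_rot]; simp
    -- What remains is the ring flow after the last dart of the block minus the ring flow before its
    -- first dart.
    rw [sum_map_telescope (p := emb.rot) (g := ringFlow f) a l hchain.left_of_append]
    · have h1 := hat _ (List.getLast_mem (List.cons_ne_nil a l))
      have h2 : G.dartVertex (emb.rot⁻¹ a) = v := (hinv a).trans (hat a List.mem_cons_self)
      have b1 := emb.abs_ringFlow_le hf (d := (a :: l).getLast (List.cons_ne_nil a l))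
        (by rw [h1]; exact hv)
      have b2 := emb.abs_ringFlow_le hf (d := emb.rot⁻¹ a) (by rw [h2]; exact hv)
      rw [h1] at b1
      rw [h2] at b2
      linarith [(abs_le.1 b1).2, (abs_le.1 b2).1]
    · intro x hx
      have := emb.dartFlow_rot hf (d := emb.rot⁻¹ x) (by rw [hinv, hat x hx]; exact hv)
      simpa using this

end PlanarEmbedding

theorem mainTheorem2 {V E : Type*} [Finite V] [Fintype E] (G : FlowNetwork V E)
    (hG : G.IsSimple) (emb : PlanarEmbedding G) (f : PlanarEmbedding.ExtArc G → ℝ)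
    (hf : emb.extended.IsFlow f) (hacyc : G.IsAcyclic (PlanarEmbedding.restrict f)) :
    G.IsFlow (PlanarEmbedding.restrict f) ∧
      ∀ v, emb.ConsecutiveAt (PlanarEmbedding.restrict f) v := by
  -- Consecutiveness needs conservation but no vertex capacities, so it is available for proving the
  -- capacity bound.
  have hcon := emb.consecutiveAt_of_isAcyclic (fun e => hf.nonneg (Sum.inl e))
    (fun v hs ht => emb.restrict_conservation hf hs ht) hacyc
  refine ⟨⟨fun e => hf.nonneg (Sum.inl e), fun e => hf.le_arcCap (Sum.inl e), fun v _ _ => ?_,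
    fun v hs ht => emb.restrict_conservation hf hs ht⟩, hcon⟩
  by_cases hv : G.vertexCap v = ⊤
  · rw [hv]; exact le_top
  · rw [ENNReal.ofReal_le_iff_le_toReal hv]
    exact emb.inflow_restrict_le hf hv (hcon v)
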